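/- A *directed monoidal category* (with strict unit) is a category $\mathcal C$ with a bifunctor $\Box:\mathcal C\times\mathcal C\to\mathcal C$, an object $0$ such that $0\,\Box\,-$ and $-\,\Box\,0$ are the identity functor, and a natural transformation $\eta_{A,B,C}:(A\Box B)\Box C\to A\Box(B\Box C)$, not necessarily invertible, which is the identity whenever one of $A,B,C$ is $0$, and which satisfies the pentagon identity $$\eta_{A,B,C\Box D}\circ\eta_{A\Box B,C,D}=(\mathrm{id}_A\Box\eta_{B,C,D})\circ\eta_{A,B\Box C,D}\circ(\eta_{A,B,C}\Box\mathrm{id}_D).$$ For $m\ge 0$ let $\mathcal L_m$ be the full subcategory of the free directed monoidal category on $m$ objects $x_1,\dots,x_m$ on those objects that become $x_1\Box x_2\Box\cdots\Box x_m$ after removing all parentheses (so $\mathcal L_0=\{0\}$). **Corollary (LaPlaza Coherence Theorem).** For every $m\ge 0$ the category $\mathcal L_m$ is a poset: any two parallel morphisms of $\mathcal L_m$ are equal, and if there are morphisms $S\to T$ and $T\to S$ then $S=T$. For $m\ge 3$ this poset is the Tamari lattice: sending a bracketed product to its underlying planar binary tree is a bijection from the objects of $\mathcal L_m$ onto the planar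 binary trees with $m$ leaves; there is a morphism $S\to T$ if and only if the tree of $T$ is obtained from that of $S$ by a finite sequence of rotations $(ab)c\to a(bc)$ of subtrees; and in this order any two trees have a least upper bound and a greatest lower bound. -/

import Mathlib

open CategoryTheory

universe v₁ v₂ u₁ u₂ u

/-- A directed monoidal category with a strict unit: a category with a bifunctor `box`, an object
`unit` such that `box unit -` and `box - unit` are the identity functor (on objects and on
morphisms), and a natural transformation `η : (A □ B) □ C ⟶ A □ (B □ C)`, not required to be
invertible, which is the identity as soon as one of `A`, `B`, `C` is the unit, and for which the
pentagon commutes. The morphisms `eqToHom _` are identities read along equalities of objects. -/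
class DirectedMonoidal (C : Type u₁) [Category.{v₁} C] where
  box : C → C → C
  unit : C
  boxHom : ∀ {A A' B B' : C}, (A ⟶ A') → (B ⟶ B') → (box A B ⟶ box A' B')
  boxHom_id : ∀ A B : C, boxHom (𝟙 A) (𝟙 B) = 𝟙 (box A B)
  boxHom_comp : ∀ {A A' A'' B B' B'' : C} (f : A ⟶ A') (f' : A' ⟶ A'') (g : B ⟶ B')
    (g' : B' ⟶ B''), boxHom (f ≫ f') (g ≫ g') = boxHom f g ≫ boxHom f' g'
  unit_box : ∀ A : C, box unit A = A
  box_unit : ∀ A : C, box A unit = A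
  unit_boxHom : ∀ {A A' : C} (f : A ⟶ A'),
    boxHom (𝟙 unit) f = eqToHom (unit_box A) ≫ f ≫ eqToHom (unit_box A').symm
  boxHom_unit : ∀ {A A' : C} (f : A ⟶ A'),
    boxHom f (𝟙 unit) = eqToHom (box_unit A) ≫ f ≫ eqToHom (box_unit A').symm
  η : ∀ A B D : C, box (box A B) D ⟶ box A (box B D)
  η_naturality : ∀ {A A' B B' D D' : C} (f : A ⟶ A') (g : B ⟶ B') (h : D ⟶ D'),
    boxHom (boxHom f g) h ≫ η A' B' D' = η A B D ≫ boxHom f (boxHom g h)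
  η_unit_left : ∀ B D : C, η unit B D = eqToHom (by rw [unit_box, unit_box])
  η_unit_mid : ∀ A D : C, η A unit D = eqToHom (by rw [box_unit, unit_box])
  η_unit_right : ∀ A B : C, η A B unit = eqToHom (by rw [box_unit, box_unit])
  pentagon : ∀ A B D E : C,
    η (box A B) D E ≫ η A B (box D E) =
      boxHom (η A B D) (𝟙 E) ≫ η A (box B D) E ≫ boxHom (𝟙 A) (η B D E)

/-! ### The free directed monoidal category on a set of objects -/

/-- The objects of the free directed monoidal category on `X`: the free unital magma on `X`. As the
unit is strict, an object is either the unit or a non-empty bracketed product of generators. -/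
inductive FreeObj (X : Type u) : Type u
  | unit : FreeObj X
  | tree : FreeMagma X → FreeObj X

namespace FreeObj

variable {X : Type u}

/-- The product of objects, with `unit` as a strict unit. -/
def box : FreeObj X → FreeObj X → FreeObj X
  | unit, B => B
  | tree s, unit => tree s
  | tree s, tree t => tree (s * t)

theorem unit_box (A : FreeObj X) : box unit A = A := rfl

theorem box_unit (A : FreeObj X) : box A unit = A := by cases A <;> rfl

end FreeObj

open FreeObj in
/-- Formal expressions for the morphisms of the free directed monoidal category on `X`. -/
inductive PreHom {X : Type u} : FreeObj X → FreeObj X → Type u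
  | id (A : FreeObj X) : PreHom A A
  | comp {A B D : FreeObj X} (f : PreHom A B) (g : PreHom B D) : PreHom A D
  | boxHom {A A' B B' : FreeObj X} (f : PreHom A A') (g : PreHom B B') :
      PreHom (box A B) (box A' B')
  | η (A B D : FreeObj X) : PreHom (box (box A B) D) (box A (box B D))

/-- Read a formal morphism along equalities of its source and of its target. -/
def PreHom.cast {X : Type u} {A A' B B' : FreeObj X} (hA : A = A') (hB : B = B')
    (f : PreHom A B) : PreHom A' B' := hA ▸ hB ▸ f

open FreeObj in
/-- The congruence on formal morphisms generated by the axioms of a directed monoidal category with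
a strict unit. -/
inductive PreHom.Rel {X : Type u} : ∀ {A B : FreeObj X}, PreHom A B → PreHom A B → Prop
  | refl {A B : FreeObj X} (f : PreHom A B) : Rel f f
  | symm {A B : FreeObj X} {f g : PreHom A B} : Rel f g → Rel g f
  | trans {A B : FreeObj X} {f g h : PreHom A B} : Rel f g → Rel g h → Rel f h
  | comp_congr {A B D : FreeObj X} {f f' : PreHom A B} {g g' : PreHom B D} :
      Rel f f' → Rel g g' → Rel (comp f g) (comp f' g')
  | boxHom_congr {A A' B B' : FreeObj X} {f f' : PreHom A A'} {g g' : PreHom B B'} :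
      Rel f f' → Rel g g' → Rel (boxHom f g) (boxHom f' g')
  | id_comp {A B : FreeObj X} (f : PreHom A B) : Rel (comp (id A) f) f
  | comp_id {A B : FreeObj X} (f : PreHom A B) : Rel (comp f (id B)) f
  | assoc {A B D E : FreeObj X} (f : PreHom A B) (g : PreHom B D) (h : PreHom D E) :
      Rel (comp (comp f g) h) (comp f (comp g h))
  | boxHom_id (A B : FreeObj X) : Rel (boxHom (id A) (id B)) (id (box A B))
  | boxHom_comp {A A' A'' B B' B'' : FreeObj X} (f : PreHom A A') (f' : PreHom A' A'')
      (g : PreHom B B') (g' : PreHom B' B'') :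
      Rel (boxHom (comp f f') (comp g g')) (comp (boxHom f g) (boxHom f' g'))
  | unit_boxHom {A A' : FreeObj X} (f : PreHom A A') :
      Rel (boxHom (id unit) f) (PreHom.cast (unit_box A).symm (unit_box A').symm f)
  | boxHom_unit {A A' : FreeObj X} (f : PreHom A A') :
      Rel (boxHom f (id unit)) (PreHom.cast (box_unit A).symm (box_unit A').symm f)
  | η_naturality {A A' B B' D D' : FreeObj X} (f : PreHom A A') (g : PreHom B B')
      (h : PreHom D D') :
      Rel (comp (boxHom (boxHom f g) h) (η A' B' D')) (comp (η A B D) (boxHom f (boxHom g h)))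
  | η_unit_left (B D : FreeObj X) :
      Rel (η unit B D) (PreHom.cast rfl (by rw [unit_box, unit_box]) (id (box (box unit B) D)))
  | η_unit_mid (A D : FreeObj X) :
      Rel (η A unit D) (PreHom.cast rfl (by rw [box_unit, unit_box]) (id (box (box A unit) D)))
  | η_unit_right (A B : FreeObj X) :
      Rel (η A B unit) (PreHom.cast rfl (by rw [box_unit, box_unit]) (id (box (box A B) unit)))
  | pentagon (A B D E : FreeObj X) :
      Rel (comp (η (box A B) D E) (η A B (box D E)))
        (comp (boxHom (η A B D) (id E)) (comp (η A (box B D) E) (boxHom (id A) (η B D E))))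

/-- Equality of morphisms in the free directed monoidal category. -/
def PreHom.setoid {X : Type u} (A B : FreeObj X) : Setoid (PreHom A B) where
  r := PreHom.Rel
  iseqv := ⟨PreHom.Rel.refl, PreHom.Rel.symm, PreHom.Rel.trans⟩

namespace FreeObj

variable {X : Type u}

instance category : Category.{u} (FreeObj X) where
  Hom A B := Quotient (PreHom.setoid A B)
  id A := Quotient.mk _ (PreHom.id A)
  comp f g := Quotient.map₂ PreHom.comp (fun _ _ h _ _ h' => PreHom.Rel.comp_congr h h') f g
  id_comp := by
    rintro A B ⟨f⟩
    exact Quotient.sound (PreHom.Rel.id_comp f)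
  comp_id := by
    rintro A B ⟨f⟩
    exact Quotient.sound (PreHom.Rel.comp_id f)
  assoc := by
    rintro A B D E ⟨f⟩ ⟨g⟩ ⟨h⟩
    exact Quotient.sound (PreHom.Rel.assoc f g h)

/-- The morphism represented by a formal expression. -/
def homMk {A B : FreeObj X} (f : PreHom A B) : A ⟶ B := Quotient.mk (PreHom.setoid A B) f

theorem homMk_cast {A A' B B' : FreeObj X} (hA : A = A') (hB : B = B') (f : PreHom A B) :
    homMk (PreHom.cast hA hB f) = eqToHom hA.symm ≫ homMk f ≫ eqToHom hB := by
  subst hA hB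
  simp [PreHom.cast]

instance directedMonoidal : DirectedMonoidal (FreeObj X) where
  box := box
  unit := unit
  boxHom f g := Quotient.map₂ PreHom.boxHom (fun _ _ h _ _ h' => PreHom.Rel.boxHom_congr h h') f g
  boxHom_id A B := Quotient.sound (PreHom.Rel.boxHom_id A B)
  boxHom_comp := by
    rintro A A' A'' B B' B'' ⟨f⟩ ⟨f'⟩ ⟨g⟩ ⟨g'⟩
    exact Quotient.sound (PreHom.Rel.boxHom_comp f f' g g')
  unit_box := unit_box
  box_unit := box_unit
  unit_boxHom := by
    rintro A A' ⟨f⟩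
    exact (Quotient.sound (PreHom.Rel.unit_boxHom f)).trans (homMk_cast _ _ f)
  boxHom_unit := by
    rintro A A' ⟨f⟩
    exact (Quotient.sound (PreHom.Rel.boxHom_unit f)).trans (homMk_cast _ _ f)
  η A B D := homMk (PreHom.η A B D)
  η_naturality := by
    rintro A A' B B' D D' ⟨f⟩ ⟨g⟩ ⟨h⟩
    exact Quotient.sound (PreHom.Rel.η_naturality f g h)
  η_unit_left B D := by
    refine (Quotient.sound (PreHom.Rel.η_unit_left B D)).trans ((homMk_cast _ _ _).trans ?_)
    exact (Category.id_comp _).trans (Category.id_comp _)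
  η_unit_mid A D := by
    refine (Quotient.sound (PreHom.Rel.η_unit_mid A D)).trans ((homMk_cast _ _ _).trans ?_)
    exact (Category.id_comp _).trans (Category.id_comp _)
  η_unit_right A B := by
    refine (Quotient.sound (PreHom.Rel.η_unit_right A B)).trans ((homMk_cast _ _ _).trans ?_)
    exact (Category.id_comp _).trans (Category.id_comp _)
  pentagon A B D E := Quotient.sound (PreHom.Rel.pentagon A B D E)

/-- The generating object attached to `x`. -/
def of (x : X) : FreeObj X := tree (FreeMagma.of x)

end FreeObj

/-! ### The universal property of the free directed monoidal category -/

/-- A functor that strictly preserves the product, the unit and the associativity morphisms. -/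
structure StrictFunctor (C : Type u₁) [Category.{v₁} C] [DirectedMonoidal C]
    (D : Type u₂) [Category.{v₂} D] [DirectedMonoidal D] extends C ⥤ D where
  obj_unit : obj DirectedMonoidal.unit = DirectedMonoidal.unit
  obj_box : ∀ A B : C,
    obj (DirectedMonoidal.box A B) = DirectedMonoidal.box (obj A) (obj B)
  map_boxHom : ∀ {A A' B B' : C} (f : A ⟶ A') (g : B ⟶ B'),
    map (DirectedMonoidal.boxHom f g) =
      eqToHom (obj_box A B) ≫ DirectedMonoidal.boxHom (map f) (map g) ≫
        eqToHom (obj_box A' B').symm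
  map_η : ∀ A B E : C,
    map (DirectedMonoidal.η A B E) =
      eqToHom (by rw [obj_box, obj_box]) ≫ DirectedMonoidal.η (obj A) (obj B) (obj E) ≫
        eqToHom (by rw [obj_box, obj_box])

namespace FreeObj

open DirectedMonoidal (boxHom_id boxHom_comp unit_boxHom boxHom_unit η_unit_left η_unit_mid
  η_unit_right)

variable {X : Type u} {D : Type u₂} [Category.{v₂} D] [DirectedMonoidal D]

theorem η_eqToHom {A A' B B' E E' : D} (p : A = A') (q : B = B') (r : E = E') :
    DirectedMonoidal.η A B E =
      eqToHom (by rw [p, q, r]) ≫ DirectedMonoidal.η A' B' E' ≫ eqToHom (by rw [p, q, r]) := by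
  subst p q r
  simp

theorem boxHom_conj_left {A₀ A A' A₁ B B' : D} (p : A₀ = A) (p' : A' = A₁) (f : A ⟶ A')
    (g : B ⟶ B') :
    DirectedMonoidal.boxHom (eqToHom p ≫ f ≫ eqToHom p') g =
      eqToHom (by rw [p]) ≫ DirectedMonoidal.boxHom f g ≫ eqToHom (by rw [p']) := by
  subst p p'
  simp

theorem boxHom_conj_right {A A' B₀ B B' B₁ : D} (q : B₀ = B) (q' : B' = B₁) (f : A ⟶ A')
    (g : B ⟶ B') :
    DirectedMonoidal.boxHom f (eqToHom q ≫ g ≫ eqToHom q') =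
      eqToHom (by rw [q]) ≫ DirectedMonoidal.boxHom f g ≫ eqToHom (by rw [q']) := by
  subst q q'
  simp

theorem boxHom_id_congr_left {A A' B B' : D} (p : A = A') (g : B ⟶ B') :
    DirectedMonoidal.boxHom (𝟙 A) g =
      eqToHom (by rw [p]) ≫ DirectedMonoidal.boxHom (𝟙 A') g ≫ eqToHom (by rw [p]) := by
  subst p
  simp

theorem boxHom_id_congr_right {A A' B B' : D} (p : B = B') (f : A ⟶ A') :
    DirectedMonoidal.boxHom f (𝟙 B) =
      eqToHom (by rw [p]) ≫ DirectedMonoidal.boxHom f (𝟙 B') ≫ eqToHom (by rw [p]) := by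
  subst p
  simp

/-- The extension of a function on generators to bracketed products. -/
def liftTree (φ : X → D) : FreeMagma X → D
  | FreeMagma.of x => φ x
  | FreeMagma.mul s t => DirectedMonoidal.box (liftTree φ s) (liftTree φ t)

/-- The extension of a function on generators to all objects. -/
def liftObj (φ : X → D) : FreeObj X → D
  | unit => DirectedMonoidal.unit
  | tree t => liftTree φ t

theorem liftObj_box (φ : X → D) (A B : FreeObj X) :
    liftObj φ (box A B) = DirectedMonoidal.box (liftObj φ A) (liftObj φ B) := by
  cases A with
  | unit => exact (DirectedMonoidal.unit_box _).symm
  | tree s =>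
    cases B with
    | unit => exact (DirectedMonoidal.box_unit _).symm
    | tree t => rfl

/-- The interpretation of formal morphisms in a directed monoidal category. -/
def liftHom (φ : X → D) : ∀ {A B : FreeObj X}, PreHom A B → (liftObj φ A ⟶ liftObj φ B)
  | _, _, PreHom.id A => 𝟙 (liftObj φ A)
  | _, _, PreHom.comp f g => liftHom φ f ≫ liftHom φ g
  | _, _, PreHom.boxHom (A := A) (A' := A') (B := B) (B' := B') f g =>
      eqToHom (liftObj_box φ A B) ≫ DirectedMonoidal.boxHom (liftHom φ f) (liftHom φ g) ≫
        eqToHom (liftObj_box φ A' B').symm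
  | _, _, PreHom.η A B E =>
      eqToHom (by rw [liftObj_box, liftObj_box]) ≫
        DirectedMonoidal.η (liftObj φ A) (liftObj φ B) (liftObj φ E) ≫
        eqToHom (by rw [liftObj_box, liftObj_box])

theorem liftHom_cast (φ : X → D) {A A' B B' : FreeObj X} (hA : A = A') (hB : B = B')
    (f : PreHom A B) :
    liftHom φ (PreHom.cast hA hB f) =
      eqToHom (by rw [hA]) ≫ liftHom φ f ≫ eqToHom (by rw [hB]) := by
  subst hA hB
  simp [PreHom.cast]

theorem liftHom_rel (φ : X → D) {A B : FreeObj X} {f g : PreHom A B} (h : PreHom.Rel f g) :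
    liftHom φ f = liftHom φ g := by
  have hu : liftObj φ unit = DirectedMonoidal.unit := rfl
  induction h with
  | refl f => rfl
  | symm _ ih => exact ih.symm
  | trans _ _ ih ih' => exact ih.trans ih'
  | comp_congr _ _ ih ih' => simp only [liftHom, ih, ih']
  | boxHom_congr _ _ ih ih' => simp only [liftHom, ih, ih']
  | id_comp f => simp [liftHom]
  | comp_id f => simp [liftHom]
  | assoc f g h => simp [liftHom]
  | boxHom_id A B => simp [liftHom, boxHom_id]
  | boxHom_comp f f' g g' => simp [liftHom, boxHom_comp]
  | unit_boxHom f =>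
    rw [liftHom_cast]
    simp [liftHom, boxHom_id_congr_left hu, unit_boxHom]
  | boxHom_unit f =>
    rw [liftHom_cast]
    simp [liftHom, boxHom_id_congr_right hu, boxHom_unit]
  | @η_naturality A A' B B' E E' f g h =>
    simp only [liftHom, boxHom_conj_left, boxHom_conj_right, Category.assoc, eqToHom_trans_assoc,
      eqToHom_refl, Category.id_comp]
    rw [← Category.assoc (DirectedMonoidal.boxHom _ _) (DirectedMonoidal.η _ _ _),
      DirectedMonoidal.η_naturality]
    simp
  | η_unit_left B E =>
    rw [liftHom_cast]
    simp [liftHom, η_eqToHom hu rfl rfl, η_unit_left]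
  | η_unit_mid A E =>
    rw [liftHom_cast]
    simp [liftHom, η_eqToHom rfl hu rfl, η_unit_mid]
  | η_unit_right A B =>
    rw [liftHom_cast]
    simp [liftHom, η_eqToHom rfl rfl hu, η_unit_right]
  | pentagon A B E F =>
    simp only [liftHom, boxHom_conj_left, boxHom_conj_right, η_eqToHom (liftObj_box φ A B) rfl rfl,
      η_eqToHom rfl (liftObj_box φ B E) rfl, η_eqToHom rfl rfl (liftObj_box φ E F),
      Category.assoc, eqToHom_trans_assoc, eqToHom_trans, eqToHom_refl, Category.id_comp]
    rw [← Category.assoc (DirectedMonoidal.η _ _ _) (DirectedMonoidal.η _ _ _),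
      DirectedMonoidal.pentagon]
    simp

/-- The strict functor that extends a function on generators. -/
def lift (φ : X → D) : StrictFunctor (FreeObj X) D where
  obj := liftObj φ
  map f := Quotient.lift (liftHom φ) (fun _ _ h => liftHom_rel φ h) f
  map_id _ := rfl
  map_comp := by
    rintro A B E ⟨f⟩ ⟨g⟩
    rfl
  obj_unit := rfl
  obj_box := liftObj_box φ
  map_boxHom := by
    rintro A A' B B' ⟨f⟩ ⟨g⟩
    rfl
  map_η _ _ _ := rfl

theorem strictFunctor_obj (φ : X → D) (F : StrictFunctor (FreeObj X) D)
    (h : ∀ x, F.obj (of x) = φ x) (A : FreeObj X) : F.obj A = liftObj φ A := by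
  cases A with
  | unit => exact F.obj_unit
  | tree t =>
    induction t with
    | ih1 x => exact h x
    | ih2 s t hs ht =>
      exact (F.obj_box (tree s) (tree t)).trans (congrArg₂ DirectedMonoidal.box hs ht)

theorem strictFunctor_map (φ : X → D) (F : StrictFunctor (FreeObj X) D)
    (h : ∀ x, F.obj (of x) = φ x) {A B : FreeObj X} (f : PreHom A B) :
    F.map (homMk f) = eqToHom (strictFunctor_obj φ F h A) ≫ liftHom φ f ≫
      eqToHom (strictFunctor_obj φ F h B).symm := by
  have hobj := strictFunctor_obj φ F h
  induction f with
  | id A =>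
    change F.map (𝟙 A) = _
    simp [liftHom]
  | comp f g hf hg =>
    change F.map (homMk f ≫ homMk g) = _
    simp [liftHom, hf, hg]
  | @boxHom A A' B B' f g hf hg =>
    change F.map (DirectedMonoidal.boxHom (homMk f) (homMk g)) = _
    rw [F.map_boxHom, hf, hg]
    simp only [liftHom, boxHom_conj_left, boxHom_conj_right, Category.assoc, eqToHom_trans,
      eqToHom_trans_assoc]
  | η A B E =>
    change F.map (DirectedMonoidal.η A B E) = _
    rw [F.map_η, η_eqToHom (hobj A) (hobj B) (hobj E)]
    simp only [liftHom, Category.assoc, eqToHom_trans, eqToHom_trans_assoc]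

/-- `FreeObj X` is the free directed monoidal category (with strict unit) on `X`. -/
theorem existsUnique_strictFunctor (φ : X → D) :
    ∃! F : StrictFunctor (FreeObj X) D, ∀ x, F.obj (of x) = φ x := by
  refine ⟨lift φ, fun _ => rfl, fun F hF => ?_⟩
  have key : F.toFunctor = (lift φ).toFunctor := by
    refine CategoryTheory.Functor.ext (strictFunctor_obj φ F hF) ?_
    rintro A B ⟨f⟩
    exact strictFunctor_map φ F hF f
  cases F
  cases key
  rfl

end FreeObj

/-! ### The categories `𝓛_m` and the Tamari lattice -/

/-- The word obtained from a bracketed product by removing all parentheses. -/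
def FreeMagma.leaves {X : Type u} : FreeMagma X → List X
  | FreeMagma.of x => [x]
  | FreeMagma.mul s t => leaves s ++ leaves t

/-- The word obtained from an object by removing all parentheses; it is empty for the unit. -/
def FreeObj.word {X : Type u} : FreeObj X → List X
  | FreeObj.unit => []
  | FreeObj.tree t => t.leaves

/-- The category `𝓛_m`: the full subcategory of the free directed monoidal category on `m`
generators on the objects that become `x_1 x_2 ⋯ x_m` after removing all parentheses. -/
abbrev LaPlaza (m : ℕ) : Type :=
  ObjectProperty.FullSubcategory (fun A : FreeObj (Fin m) => A.word = List.finRange m)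

/-- The planar binary tree underlying a bracketed product. -/
def FreeMagma.shape {X : Type u} : FreeMagma X → BinaryTree Unit
  | FreeMagma.of _ => BinaryTree.nil
  | FreeMagma.mul s t => BinaryTree.node () (shape s) (shape t)

/-- A single rotation `(ab)c ⟶ a(bc)`, performed at some node of a planar binary tree. -/
inductive Rotation : BinaryTree Unit → BinaryTree Unit → Prop
  | root (a b c : BinaryTree Unit) :
      Rotation (.node () (.node () a b) c) (.node () a (.node () b c))
  | left {a a' : BinaryTree Unit} (b : BinaryTree Unit) :
      Rotation a a' → Rotation (.node () a b) (.node () a' b)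
  | right (a : BinaryTree Unit) {b b' : BinaryTree Unit} :
      Rotation b b' → Rotation (.node () a b) (.node () a b')

/-- The planar binary trees with `m` leaves, that is, the complete bracketings of a product of `m`
factors. -/
def Tamari (m : ℕ) : Type := {t : BinaryTree Unit // t.numLeaves = m}

/-- The Tamari order: `s ≤ t` if `t` is obtained from `s` by a finite sequence of rotations. -/
instance Tamari.preorder (m : ℕ) : Preorder (Tamari m) where
  le s t := Relation.ReflTransGen Rotation s.1 t.1
  le_refl _ := Relation.ReflTransGen.refl
  le_trans _ _ _ h h' := h.trans h'

/-! By strictness of the unit, every morphism between bracketed products is composed of products and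
associativity morphisms of bracketed products. Each node on the left spine of a product `S` gives a
canonical morphism `S ⟶ P □ Q`, a *cut* of `S`, and a cut is determined by the length of `P`.
Naturality and the pentagon show that cuts of the target of a morphism lift to cuts of its source,
so that every `f : S ⟶ T₁ □ T₂` is a cut `S ⟶ P □ Q` followed by a product of morphisms `P ⟶ T₁` and
`Q ⟶ T₂`. As morphisms preserve the underlying word, the length of `P` is that of `T₁`: parallel
morphisms factor through the same cut, and are equal by induction on the target.

One tree is reached from another by rotations if and only if its bracket vector is componentwise
larger: an entry that no earlier bracket reaches can be rotated to the root, which allows one to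
build the larger tree from the root downwards. The componentwise minimum of two bracket vectors is
again a bracket vector, whence greatest lower bounds. Least upper bounds follow, as there are
finitely many trees and a largest one, the right comb. -/

theorem exists_isLUB_of_exists_isGLB {α : Type*} [Preorder α] [WellFoundedLT α]
    (exists_isGLB : ∀ a b : α, ∃ c, IsGLB {a, b} c) {S : Set α} (hS : BddAbove S) :
    ∃ c, IsLUB S c := by
  obtain ⟨c, hc⟩ : ∃ c, Minimal (· ∈ upperBounds S) c := exists_minimal_of_wellFoundedLT _ hS
  -- The meet of `c` with any other upper bound is again an upper bound.
  refine ⟨c, hc.prop, fun u hu => ?_⟩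
  obtain ⟨k, hk⟩ := exists_isGLB c u
  have hkc : k ≤ c := hk.1 (Set.mem_insert _ _)
  have hku : k ≤ u := hk.1 (Set.mem_insert_of_mem _ rfl)
  have hkS : k ∈ upperBounds S := fun s hs => hk.2 <| by
    rintro _ (rfl | rfl)
    exacts [hc.prop hs, hu hs]
  exact (hc.le_of_le hkS hkc).trans hku

section Componentwise

open List

variable {α : Type*}

theorem forall₂_le_trans [Preorder α] {k l l' : List α} (h : Forall₂ (· ≤ ·) k l)
    (h' : Forall₂ (· ≤ ·) l l') : Forall₂ (· ≤ ·) k l' := by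
  induction h generalizing l' with
  | nil => exact h'
  | cons hx _ ih =>
    cases h' with
    | cons hx' h' => exact .cons (hx.trans hx') (ih h')

theorem forall₂_le_antisymm [PartialOrder α] {l l' : List α} (h : Forall₂ (· ≤ ·) l l')
    (h' : Forall₂ (· ≤ ·) l' l) : l = l' := by
  induction h with
  | nil => rfl
  | cons hx _ ih =>
    obtain ⟨hx', h'⟩ := forall₂_cons.mp h'
    rw [hx.antisymm hx', ih h']

variable [SemilatticeInf α]

theorem forall₂_zipWith_inf_le_left {l l' : List α} (h : l.length = l'.length) :
    Forall₂ (· ≤ ·) (zipWith (· ⊓ ·) l l') l := by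
  induction l generalizing l' with
  | nil => exact .nil
  | cons x l ih =>
    obtain ⟨x', l', rfl⟩ := exists_cons_of_length_eq_add_one h.symm
    exact .cons inf_le_left (ih (Nat.succ.inj h))

theorem forall₂_zipWith_inf_le_right {l l' : List α} (h : l.length = l'.length) :
    Forall₂ (· ≤ ·) (zipWith (· ⊓ ·) l l') l' := by
  rw [zipWith_comm_of_comm inf_comm]
  exact forall₂_zipWith_inf_le_left h.symm

theorem forall₂_le_zipWith_inf {k l l' : List α} (h : Forall₂ (· ≤ ·) k l)
    (h' : Forall₂ (· ≤ ·) k l') : Forall₂ (· ≤ ·) k (zipWith (· ⊓ ·) l l') := by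
  induction h generalizing l' with
  | nil => exact .nil
  | cons hx _ ih =>
    cases h' with
    | cons hx' h' => exact .cons (le_inf hx hx') (ih h')

end Componentwise

/-! ### Bracket vectors -/

namespace Tamari

open BinaryTree List

/-- The bracket vector of a tree: the sizes of the right subtrees of its nodes, listed in inorder.
Each entry is thought of as opening a bracket that spans that many of the following entries. -/
def bracketVector : BinaryTree Unit → List ℕ
  | .nil => []
  | node _ a b => bracketVector a ++ b.numNodes :: bracketVector b

@[simp]
theorem length_bracketVector (t : BinaryTree Unit) : (bracketVector t).length = t.numNodes := by
  induction t with
  | nil => rfl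
  | node _ a b iha ihb =>
    rw [bracketVector, length_append, length_cons, iha, ihb, numNodes]
    omega

/-- Every bracket opened in the list closes within the list, where a bracket `x` spans the `x`
entries that follow it. -/
def Closes : List ℕ → Prop
  | [] => True
  | x :: l => x ≤ l.length ∧ Closes l

theorem Closes.append {l l' : List ℕ} (h : Closes l) (h' : Closes l') : Closes (l ++ l') := by
  induction l with
  | nil => exact h'
  | cons x l ih =>
    rw [cons_append]
    exact ⟨h.1.trans (by rw [length_append]; omega), ih h.2⟩

theorem Closes.right_of_append {l l' : List ℕ} (h : Closes (l ++ l')) : Closes l' := by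
  induction l with
  | nil => exact h
  | cons x l ih => exact ih h.2

theorem Closes.anti {l l' : List ℕ} (h : Forall₂ (· ≤ ·) l l') (h' : Closes l') : Closes l := by
  induction h with
  | nil => trivial
  | cons hx h ih => exact ⟨(hx.trans h'.1).trans_eq h.length_eq.symm, ih h'.2⟩

theorem closes_bracketVector (t : BinaryTree Unit) : Closes (bracketVector t) := by
  induction t with
  | nil => trivial
  | node _ a b iha ihb => exact iha.append ⟨(length_bracketVector b).ge, ihb⟩

/-- Well-nested brackets: the span of every entry fits into the list and contains all brackets that
are opened in it. These are the lists that occur as bracket vectors. -/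
inductive IsBracketVector : List ℕ → Prop
  | nil : IsBracketVector []
  | cons {x : ℕ} {l : List ℕ} : x ≤ l.length → Closes (l.take x) → IsBracketVector l →
      IsBracketVector (x :: l)

theorem IsBracketVector.append {l l' : List ℕ} (h : IsBracketVector l) (h' : IsBracketVector l') :
    IsBracketVector (l ++ l') := by
  induction h with
  | nil => exact h'
  | cons hx hc _ ih =>
    rw [cons_append]
    refine .cons ?_ ?_ ih
    · rw [length_append]
      omega
    · rwa [take_append_of_le_length hx]

theorem isBracketVector_bracketVector (t : BinaryTree Unit) :
    IsBracketVector (bracketVector t) := by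
  induction t with
  | nil => exact .nil
  | node _ a b iha ihb =>
    refine iha.append (.cons (length_bracketVector b).ge ?_ ihb)
    rw [← length_bracketVector b, take_length]
    exact closes_bracketVector b

theorem IsBracketVector.zipWith_inf {l l' : List ℕ} (h : IsBracketVector l)
    (h' : IsBracketVector l') (hlen : l.length = l'.length) :
    IsBracketVector (zipWith (· ⊓ ·) l l') := by
  induction h generalizing l' with
  | nil => exact .nil
  | @cons x l hx hc _ ih =>
    cases h' with
    | nil => cases hlen
    | @cons x' l' hx' hc' h' =>
      have hlen : l.length = l'.length := Nat.succ.inj hlen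
      have hlen_take (n : ℕ) : (l.take n).length = (l'.take n).length := by
        rw [length_take, length_take, hlen]
      refine .cons ?_ ?_ (ih h' hlen)
      · rw [length_zipWith]
        exact inf_le_inf hx hx'
      · change Closes (take (x ⊓ x') (zipWith (· ⊓ ·) l l'))
        rw [take_zipWith]
        rcases le_total x x' with hle | hle
        · rw [inf_eq_left.mpr hle]
          exact hc.anti (forall₂_zipWith_inf_le_left (hlen_take x))
        · rw [inf_eq_right.mpr hle]
          exact hc'.anti (forall₂_zipWith_inf_le_right (hlen_take x'))

theorem exists_bracketVector_eq_cons (t : BinaryTree Unit) {x : ℕ} (hx : x ≤ t.numNodes)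
    (hc : Closes ((bracketVector t).take x)) :
    ∃ t', bracketVector t' = x :: bracketVector t := by
  induction t with
  | nil =>
    obtain rfl : x = 0 := Nat.le_zero.mp hx
    exact ⟨node () .nil .nil, rfl⟩
  | node _ a b iha _ =>
    rcases le_or_gt x a.numNodes with hxa | hxa
    · rw [bracketVector, take_append_of_le_length (by simpa)] at hc
      obtain ⟨a', ha'⟩ := iha hxa hc
      exact ⟨node () a' b, by rw [bracketVector, ha', bracketVector, cons_append]⟩
    · -- The bracket of the root lies in the span of the new entry, hence so does the whole tree.
      have hroot : Closes (b.numNodes :: (bracketVector b).take (x - a.numNodes - 1)) := by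
        rw [bracketVector, take_append, length_bracketVector,
          show x - a.numNodes = x - a.numNodes - 1 + 1 by omega, take_succ_cons] at hc
        exact hc.right_of_append
      have hxt : x = (node () a b).numNodes := by
        have := hroot.1
        rw [length_take] at this
        rw [numNodes] at hx ⊢
        omega
      exact ⟨node () .nil (node () a b), by rw [bracketVector, hxt]; rfl⟩

theorem IsBracketVector.exists_bracketVector_eq {l : List ℕ} (h : IsBracketVector l) :
    ∃ t, bracketVector t = l := by
  induction h with
  | nil => exact ⟨.nil, rfl⟩
  | cons hx hc _ ih =>
    obtain ⟨t, rfl⟩ := ih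
    exact exists_bracketVector_eq_cons t (by simpa using hx) hc

theorem bracketVector_node_eq_append {a b : BinaryTree Unit} {x : ℕ} {l₁ l₂ : List ℕ}
    (hl₁ : Closes l₁) (h : bracketVector (node () a b) = l₁ ++ x :: l₂) :
    (bracketVector a = l₁ ∧ b.numNodes = x ∧ bracketVector b = l₂) ∨
      ∃ l, bracketVector a = l₁ ++ x :: l ∧ l₂ = l ++ b.numNodes :: bracketVector b := by
  rw [bracketVector] at h
  rcases append_eq_append_iff.mp h with ⟨_ | ⟨y, l⟩, rfl, hl⟩ | ⟨_ | ⟨y, l⟩, ha, hl⟩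
  · obtain ⟨hx, hb⟩ := cons.inj hl
    exact .inl ⟨(append_nil _).symm, hx, hb⟩
  · -- The bracket of the root would have to close in `l₁`, before the entry `x`.
    obtain ⟨rfl, hb : bracketVector b = l ++ x :: l₂⟩ := cons.inj hl
    have hroot : b.numNodes ≤ l.length := hl₁.right_of_append.1
    have hlen := congrArg length hb
    rw [length_bracketVector, length_append, length_cons] at hlen
    omega
  · obtain ⟨hx, hb⟩ := cons.inj hl
    exact .inl ⟨ha.trans (append_nil _), hx.symm, hb.symm⟩
  · obtain ⟨rfl, rfl⟩ := cons.inj hl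
    exact .inr ⟨l, ha, rfl⟩

theorem bracketVector_injective : Function.Injective bracketVector := by
  intro s t h
  induction s generalizing t with
  | nil => cases t with
    | nil => rfl
    | node => simp [bracketVector] at h
  | node _ a b iha ihb => cases t with
    | nil => simp [bracketVector] at h
    | node _ c d =>
      have hab := bracketVector_node_eq_append (closes_bracketVector c) h
      have hcd := bracketVector_node_eq_append (closes_bracketVector a) h.symm
      rcases hab with ⟨ha, -, hb⟩ | ⟨l, ha, -⟩
      · rw [iha ha, ihb hb]
      · have hca : (bracketVector c).length < (bracketVector a).length := by simp [ha]
        have hac : (bracketVector a).length ≤ (bracketVector c).length := by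
          rcases hcd with ⟨hc, -⟩ | ⟨l', hc, -⟩
          · rw [hc]
          · rw [hc, length_append]
            omega
        exact absurd hac hca.not_ge

end Tamari

/-! ### Rotations as the componentwise order of bracket vectors -/

namespace Rotation

open BinaryTree List Relation Tamari

theorem reflTransGen_node {a a' b b' : BinaryTree Unit} (ha : ReflTransGen Rotation a a')
    (hb : ReflTransGen Rotation b b') :
    ReflTransGen Rotation (node () a b) (node () a' b') :=
  (ha.lift (node () · b) fun _ _ => left b).trans (hb.lift (node () a' ·) fun _ _ => right a')

theorem bracketVector_le {s t : BinaryTree Unit} (h : Rotation s t) :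
    Forall₂ (· ≤ ·) (bracketVector s) (bracketVector t) := by
  induction h with
  | root a b c =>
    have hb : b.numNodes ≤ (node () b c).numNodes := by
      rw [numNodes]
      omega
    simp only [bracketVector, append_assoc, cons_append]
    exact rel_append (forall₂_refl _) (.cons hb (forall₂_refl _))
  | left b _ ih => exact rel_append ih (forall₂_refl _)
  | @right a b b' _ ih =>
    have hb : b.numNodes = b'.numNodes := by simpa using ih.length_eq
    exact rel_append (forall₂_refl _) (.cons hb.le ih)

theorem exists_reflTransGen_node {s : BinaryTree Unit} {x : ℕ} {l₁ l₂ : List ℕ}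
    (hl₁ : Closes l₁) (h : bracketVector s = l₁ ++ x :: l₂) :
    ∃ p q, ReflTransGen Rotation s (node () p q) ∧ bracketVector p = l₁ ∧
      bracketVector q = l₂ := by
  induction s generalizing l₂ with
  | nil => simp [bracketVector] at h
  | node _ a b iha _ =>
    rcases bracketVector_node_eq_append hl₁ h with ⟨ha, -, hb⟩ | ⟨l, ha, rfl⟩
    · exact ⟨a, b, .refl, ha, hb⟩
    · obtain ⟨p, q, hr, hp, rfl⟩ := iha ha
      exact ⟨p, node () q b, (reflTransGen_node hr .refl).tail (.root p q b), hp, rfl⟩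

theorem reflTransGen_of_bracketVector_le {s t : BinaryTree Unit}
    (h : Forall₂ (· ≤ ·) (bracketVector s) (bracketVector t)) : ReflTransGen Rotation s t := by
  induction t generalizing s with
  | nil =>
    obtain rfl : s = .nil := bracketVector_injective (forall₂_nil_right_iff.mp h)
    exact .refl
  | node _ a b iha ihb =>
    obtain ⟨x, l₁, l₂, ha, hb, hs⟩ : ∃ x l₁ l₂, Forall₂ (· ≤ ·) l₁ (bracketVector a) ∧
        Forall₂ (· ≤ ·) l₂ (bracketVector b) ∧ bracketVector s = l₁ ++ x :: l₂ := by
      have ha := forall₂_take_append _ _ _ h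
      have hb := forall₂_drop_append _ _ _ h
      obtain ⟨x, l₂, -, hb, hdrop⟩ := forall₂_cons_right_iff.mp hb
      exact ⟨x, _, l₂, ha, hb, by rw [← hdrop, take_append_drop]⟩
    -- In `s`, too, no bracket opened before the root entry of `t` reaches it.
    obtain ⟨p, q, hr, rfl, rfl⟩ :=
      exists_reflTransGen_node ((closes_bracketVector a).anti ha) hs
    exact hr.trans (reflTransGen_node (iha ha) (ihb hb))

theorem reflTransGen_iff_bracketVector_le {s t : BinaryTree Unit} :
    ReflTransGen Rotation s t ↔ Forall₂ (· ≤ ·) (bracketVector s) (bracketVector t) := by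
  refine ⟨fun h => ?_, reflTransGen_of_bracketVector_le⟩
  induction h with
  | refl => exact forall₂_refl _
  | tail _ h ih => exact forall₂_le_trans ih h.bracketVector_le

theorem reflTransGen_antisymm {s t : BinaryTree Unit} (h : ReflTransGen Rotation s t)
    (h' : ReflTransGen Rotation t s) : s = t :=
  bracketVector_injective <| forall₂_le_antisymm (reflTransGen_iff_bracketVector_le.mp h)
    (reflTransGen_iff_bracketVector_le.mp h')

end Rotation

/-! ### The lattice property -/

namespace Tamari

open BinaryTree List Rotation

/-- The right comb with `n` nodes, the largest tree in the Tamari order. -/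
def rightComb : ℕ → BinaryTree Unit
  | 0 => .nil
  | n + 1 => node () .nil (rightComb n)

theorem numNodes_rightComb (n : ℕ) : (rightComb n).numNodes = n := by
  induction n with
  | zero => rfl
  | succ n ih => rw [rightComb, numNodes, ih, numNodes, zero_add]

theorem Closes.le_bracketVector_rightComb {l : List ℕ} (h : Closes l) :
    Forall₂ (· ≤ ·) l (bracketVector (rightComb l.length)) := by
  induction l with
  | nil => exact .nil
  | cons x l ih => exact .cons (h.1.trans_eq (numNodes_rightComb _).symm) (ih h.2)

variable {m : ℕ}

theorem numNodes_add_one (t : Tamari m) : t.1.numNodes + 1 = m := by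
  rw [← numLeaves_eq_numNodes_succ, t.2]

theorem le_iff_bracketVector_le {s t : Tamari m} :
    s ≤ t ↔ Forall₂ (· ≤ ·) (bracketVector s.1) (bracketVector t.1) :=
  reflTransGen_iff_bracketVector_le

instance finite : Finite (Tamari m) :=
  Set.Finite.to_subtype <| (treesOfNumNodesEq (m - 1)).finite_toSet.subset fun t ht => by
    have htm : t.numNodes + 1 = m := numNodes_add_one ⟨t, ht⟩
    simp only [Finset.mem_coe, mem_treesOfNumNodesEq]
    omega

theorem exists_isGLB_pair (s t : Tamari m) : ∃ k, IsGLB {s, t} k := by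
  have hs := s.numNodes_add_one
  have ht := t.numNodes_add_one
  have hlen : (bracketVector s.1).length = (bracketVector t.1).length := by
    simp only [length_bracketVector]
    omega
  obtain ⟨k, hk⟩ := ((isBracketVector_bracketVector s.1).zipWith_inf
    (isBracketVector_bracketVector t.1) hlen).exists_bracketVector_eq
  have hkm : k.numLeaves = m := by
    rw [numLeaves_eq_numNodes_succ, ← length_bracketVector, hk, length_zipWith, ← hlen, min_self,
      length_bracketVector, hs]
  refine ⟨⟨k, hkm⟩, ?_, fun r hr => ?_⟩
  · rintro _ (rfl | rfl)
    · exact le_iff_bracketVector_le.mpr (hk ▸ forall₂_zipWith_inf_le_left hlen)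
    · exact le_iff_bracketVector_le.mpr (hk ▸ forall₂_zipWith_inf_le_right hlen)
  · have hrs := le_iff_bracketVector_le.mp (hr (Set.mem_insert _ _))
    have hrt := le_iff_bracketVector_le.mp (hr (Set.mem_insert_of_mem _ rfl))
    exact le_iff_bracketVector_le.mpr (hk ▸ forall₂_le_zipWith_inf hrs hrt)

theorem exists_isTop (hm : 0 < m) : ∃ t : Tamari m, IsTop t := by
  refine ⟨⟨rightComb (m - 1), ?_⟩, fun s => le_iff_bracketVector_le.mpr ?_⟩
  · rw [numLeaves_eq_numNodes_succ, numNodes_rightComb]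
    omega
  · have hs : (bracketVector s.1).length = m - 1 := by
      have := s.numNodes_add_one
      rw [length_bracketVector]
      omega
    have hle := (closes_bracketVector s.1).le_bracketVector_rightComb
    rwa [hs] at hle

theorem exists_isLUB_pair (s t : Tamari m) : ∃ j, IsLUB {s, t} j := by
  obtain ⟨top, htop⟩ := exists_isTop (m := m) (by have := s.numNodes_add_one; omega)
  exact exists_isLUB_of_exists_isGLB exists_isGLB_pair ⟨top, fun r _ => htop r⟩

end Tamari

/-! ### Morphisms without units -/

namespace FreeObj

variable {X : Type u}

/-- The product of two morphisms between bracketed products. Its source and target are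
definitionally the values of `DirectedMonoidal.box`, but do not mention `box`. -/
def treeBox {s s' t t' : FreeMagma X} (f : tree s ⟶ tree s') (g : tree t ⟶ tree t') :
    tree (.mul s t) ⟶ tree (.mul s' t') :=
  DirectedMonoidal.boxHom f g

/-- The associativity morphism of three bracketed products, with source and target spelled out as
in `treeBox`. -/
def treeη (a b c : FreeMagma X) : tree (.mul (.mul a b) c) ⟶ tree (.mul a (.mul b c)) :=
  DirectedMonoidal.η (tree a) (tree b) (tree c)

theorem treeBox_id (s t : FreeMagma X) : treeBox (𝟙 (tree s)) (𝟙 (tree t)) = 𝟙 _ :=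
  DirectedMonoidal.boxHom_id (tree s) (tree t)

theorem treeBox_comp {s s' s'' t t' t'' : FreeMagma X} (f : tree s ⟶ tree s')
    (f' : tree s' ⟶ tree s'') (g : tree t ⟶ tree t') (g' : tree t' ⟶ tree t'') :
    treeBox (f ≫ f') (g ≫ g') = treeBox f g ≫ treeBox f' g' :=
  DirectedMonoidal.boxHom_comp f f' g g'

theorem treeη_naturality {a a' b b' c c' : FreeMagma X} (f : tree a ⟶ tree a')
    (g : tree b ⟶ tree b') (h : tree c ⟶ tree c') :
    treeBox (treeBox f g) h ≫ treeη a' b' c' = treeη a b c ≫ treeBox f (treeBox g h) :=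
  DirectedMonoidal.η_naturality f g h

theorem treeη_pentagon (a b c d : FreeMagma X) :
    treeη (.mul a b) c d ≫ treeη a b (.mul c d) =
      treeBox (treeη a b c) (𝟙 _) ≫ treeη a (.mul b c) d ≫ treeBox (𝟙 _) (treeη b c d) :=
  DirectedMonoidal.pentagon (tree a) (tree b) (tree c) (tree d)

theorem word_box (A B : FreeObj X) : (box A B).word = A.word ++ B.word := by
  match A, B with
  | unit, _ => rfl
  | tree s, unit => exact (List.append_nil s.leaves).symm
  | tree _, tree _ => rfl

theorem word_eq_of_hom {A B : FreeObj X} (f : A ⟶ B) : A.word = B.word := by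
  obtain ⟨e⟩ := f
  clear f
  induction e with
  | id A => rfl
  | comp _ _ hf hg => exact hf.trans hg
  | boxHom _ _ hf hg => rw [word_box, word_box, hf, hg]
  | η A B D => simp only [word_box, List.append_assoc]

theorem numLeaves_shape_eq_length_leaves (t : FreeMagma X) :
    t.shape.numLeaves = t.leaves.length := by
  induction t with
  | ih1 x => rfl
  | ih2 s t hs ht => exact (congrArg₂ _ hs ht).trans List.length_append.symm

theorem length_leaves_pos (t : FreeMagma X) : 0 < t.leaves.length :=
  numLeaves_shape_eq_length_leaves t ▸ t.shape.numLeaves_pos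

theorem one_lt_length_leaves_mul (s t : FreeMagma X) :
    1 < (FreeMagma.mul s t).leaves.length := by
  have hs := length_leaves_pos s
  have ht := length_leaves_pos t
  rw [FreeMagma.leaves, List.length_append]
  omega

theorem length_leaves_lt_of_hom {A : FreeObj X} {p q : FreeMagma X} (f : A ⟶ tree (.mul p q)) :
    p.leaves.length < A.word.length := by
  rw [word_eq_of_hom f, word, FreeMagma.leaves, List.length_append]
  exact Nat.lt_add_of_pos_right (length_leaves_pos q)

theorem eq_unit_of_word_eq_nil {A : FreeObj X} (h : A.word = []) : A = unit := by
  cases A with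
  | unit => rfl
  | tree t => exact absurd (congrArg List.length h) (length_leaves_pos t).ne'

/-- The morphisms that can be written without the unit object. By strictness of the unit these are
all morphisms (`unitFree`), which gives an induction principle that never splits a product
`box A B` into cases. -/
inductive UnitFree : ∀ {A B : FreeObj X}, (A ⟶ B) → Prop
  | id (A : FreeObj X) : UnitFree (𝟙 A)
  | comp {A B D : FreeObj X} {f : A ⟶ B} {g : B ⟶ D} :
      UnitFree f → UnitFree g → UnitFree (f ≫ g)
  | treeBox {s s' t t' : FreeMagma X} {f : tree s ⟶ tree s'} {g : tree t ⟶ tree t'} :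
      UnitFree f → UnitFree g → UnitFree (treeBox f g)
  | treeη (a b c : FreeMagma X) : UnitFree (treeη a b c)

theorem UnitFree.eqToHom {A B : FreeObj X} (h : A = B) : UnitFree (eqToHom h) := by
  subst h
  exact .id A

theorem UnitFree.exists_eq_eqToHom {A B : FreeObj X} {f : A ⟶ B} (hf : UnitFree f)
    (hB : B.word.length ≤ 1) : ∃ h : A = B, f = CategoryTheory.eqToHom h := by
  induction hf with
  | id A => exact ⟨rfl, rfl⟩
  | comp _ _ ihf ihg =>
    obtain ⟨rfl, rfl⟩ := ihg hB
    obtain ⟨rfl, rfl⟩ := ihf hB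
    exact ⟨rfl, Category.id_comp _⟩
  | treeBox => exact absurd hB (one_lt_length_leaves_mul _ _).not_ge
  | treeη => exact absurd hB (one_lt_length_leaves_mul _ _).not_ge

theorem UnitFree.boxHom {A A' B B' : FreeObj X} {f : A ⟶ A'} {g : B ⟶ B'} (hf : UnitFree f)
    (hg : UnitFree g) : UnitFree (DirectedMonoidal.boxHom f g) := by
  match A, A', B, B', f, g, hf, hg with
  | unit, A', B, B', f, g, hf, hg =>
    obtain rfl := eq_unit_of_word_eq_nil (word_eq_of_hom f).symm
    obtain ⟨_, rfl⟩ := hf.exists_eq_eqToHom (Nat.zero_le 1)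
    exact DirectedMonoidal.unit_boxHom g ▸ (UnitFree.eqToHom _).comp (hg.comp (.eqToHom _))
  | A, A', unit, B', f, g, hf, hg =>
    obtain rfl := eq_unit_of_word_eq_nil (word_eq_of_hom g).symm
    obtain ⟨_, rfl⟩ := hg.exists_eq_eqToHom (Nat.zero_le 1)
    exact DirectedMonoidal.boxHom_unit f ▸ (UnitFree.eqToHom _).comp (hf.comp (.eqToHom _))
  | tree _, unit, _, _, f, _, _, _ =>
    cases eq_unit_of_word_eq_nil (word_eq_of_hom f)
  | _, _, tree _, unit, _, g, _, _ =>
    cases eq_unit_of_word_eq_nil (word_eq_of_hom g)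
  | tree _, tree _, tree _, tree _, _, _, hf, hg => exact .treeBox hf hg

theorem UnitFree.η (A B D : FreeObj X) : UnitFree (DirectedMonoidal.η A B D) := by
  match A, B, D with
  | unit, B, D => exact DirectedMonoidal.η_unit_left B D ▸ .eqToHom _
  | A, unit, D => exact DirectedMonoidal.η_unit_mid A D ▸ .eqToHom _
  | A, B, unit => exact DirectedMonoidal.η_unit_right A B ▸ .eqToHom _
  | tree a, tree b, tree c => exact .treeη a b c

theorem unitFree {A B : FreeObj X} (f : A ⟶ B) : UnitFree f := by
  obtain ⟨e⟩ := f
  clear f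
  induction e with
  | id A => exact .id A
  | comp _ _ hf hg => exact .comp hf hg
  | boxHom _ _ hf hg => exact .boxHom hf hg
  | η A B D => exact .η A B D

/-! ### Coherence -/

/-- The canonical morphisms `(⋯((P □ Q₁) □ Q₂)⋯) □ Qₙ ⟶ P □ ((⋯(Q₁ □ Q₂)⋯) □ Qₙ)`, one for each
node on the left spine of the source. -/
inductive IsCut : ∀ {A : FreeObj X} {p q : FreeMagma X}, (A ⟶ tree (.mul p q)) → Prop
  | root (p q : FreeMagma X) : IsCut (𝟙 (tree (.mul p q)))
  | step {s p q : FreeMagma X} {c : tree s ⟶ tree (.mul p q)} (r : FreeMagma X) :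
      IsCut c → IsCut (treeBox c (𝟙 (tree r)) ≫ treeη p q r)

theorem IsCut.eq_of_length_eq {A : FreeObj X} {p q p' q' : FreeMagma X}
    {c : A ⟶ tree (.mul p q)} {c' : A ⟶ tree (.mul p' q')} (hc : IsCut c) (hc' : IsCut c')
    (hlen : p.leaves.length = p'.leaves.length) :
    (⟨p, q, c⟩ : Σ p q : FreeMagma X, A ⟶ tree (.mul p q)) = ⟨p', q', c'⟩ := by
  induction hc generalizing p' q' with
  | root p q =>
    cases hc' with
    | root => rfl
    | @step _ _ _ c' => exact absurd hlen (length_leaves_lt_of_hom c').ne'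
  | @step _ _ _ c _ _ ih =>
    cases hc' with
    | root => exact absurd hlen (length_leaves_lt_of_hom c).ne
    | step _ hc' =>
      cases ih hc' hlen
      rfl

/-- Every cut of the target of `f` pulls back to a cut of the source. Applied to the trivial cut of
a product, this factors `f` through a product of morphisms. -/
def LiftsCuts {A B : FreeObj X} (f : A ⟶ B) : Prop :=
  ∀ ⦃p q : FreeMagma X⦄ ⦃c : B ⟶ tree (.mul p q)⦄, IsCut c →
    ∃ (p' q' : FreeMagma X) (c' : A ⟶ tree (.mul p' q')) (a : tree p' ⟶ tree p)
      (b : tree q' ⟶ tree q), IsCut c' ∧ f ≫ c = c' ≫ treeBox a b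

theorem liftsCuts_id (A : FreeObj X) : LiftsCuts (𝟙 A) := fun p q c hc =>
  ⟨p, q, c, 𝟙 _, 𝟙 _, hc, by rw [treeBox_id, Category.id_comp, Category.comp_id]⟩

theorem LiftsCuts.comp {A B D : FreeObj X} {f : A ⟶ B} {g : B ⟶ D} (hf : LiftsCuts f)
    (hg : LiftsCuts g) : LiftsCuts (f ≫ g) := by
  intro p q c hc
  obtain ⟨p₁, q₁, c₁, a₁, b₁, hc₁, hg⟩ := hg hc
  obtain ⟨p₂, q₂, c₂, a₂, b₂, hc₂, hf⟩ := hf hc₁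
  refine ⟨p₂, q₂, c₂, a₂ ≫ a₁, b₂ ≫ b₁, hc₂, ?_⟩
  rw [Category.assoc, hg, reassoc_of% hf, treeBox_comp]

theorem liftsCuts_treeBox {s s' t t' : FreeMagma X} {f : tree s ⟶ tree s'}
    (hf : LiftsCuts f) (g : tree t ⟶ tree t') : LiftsCuts (treeBox f g) := by
  intro p q c hc
  cases hc with
  | root => exact ⟨s, t, 𝟙 _, f, g, .root s t, by rw [Category.id_comp, Category.comp_id]⟩
  | @step _ p q c _ hc =>
    obtain ⟨p', q', c', a, b, hc', hfc⟩ := hf hc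
    refine ⟨p', _, _, a, treeBox b g, .step t hc', ?_⟩
    calc treeBox f g ≫ treeBox c (𝟙 _) ≫ treeη p q t'
        = treeBox (f ≫ c) g ≫ treeη p q t' := by
          rw [← Category.assoc, ← treeBox_comp, Category.comp_id]
      _ = treeBox c' (𝟙 _) ≫ treeBox (treeBox a b) g ≫
            treeη p q t' := by
          rw [hfc, ← Category.assoc, ← treeBox_comp, Category.id_comp]
      _ = (treeBox c' (𝟙 _) ≫ treeη p' q' t) ≫
            treeBox a (treeBox b g) := by
          rw [treeη_naturality, Category.assoc]

theorem liftsCuts_treeη (a b d : FreeMagma X) : LiftsCuts (treeη a b d) := by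
  intro p q c hc
  cases hc with
  | root =>
    refine ⟨a, _, _, 𝟙 _, 𝟙 _, .step d (.root a b), ?_⟩
    rw [treeBox_id, treeBox_id, Category.id_comp, Category.comp_id]
  | @step _ p q c _ hc =>
    -- The pentagon compares the extensions of a cut of `a` to `(a □ b) □ d` and to `a □ (b □ d)`.
    refine ⟨p, _, _, 𝟙 _, treeη q b d, .step d (.step b hc), ?_⟩
    calc treeη a b d ≫ treeBox c (𝟙 _) ≫ treeη p q (.mul b d)
        = treeBox (treeBox c (𝟙 _)) (𝟙 _) ≫ treeη (.mul p q) b d ≫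
            treeη p q (.mul b d) := by
          rw [← treeBox_id b d, ← Category.assoc, ← treeη_naturality, Category.assoc]
      _ = (treeBox (treeBox c (𝟙 _)) (𝟙 _) ≫
            treeBox (treeη p q b) (𝟙 _)) ≫ treeη p (.mul q b) d ≫
            treeBox (𝟙 _) (treeη q b d) := by
          rw [treeη_pentagon, Category.assoc]
      _ = (treeBox (treeBox c (𝟙 _) ≫ treeη p q b) (𝟙 _) ≫
            treeη p (.mul q b) d) ≫ treeBox (𝟙 _) (treeη q b d) := by
          rw [← treeBox_comp, Category.comp_id, Category.assoc]

theorem liftsCuts {A B : FreeObj X} (f : A ⟶ B) : LiftsCuts f := by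
  induction unitFree f with
  | id A => exact liftsCuts_id A
  | comp _ _ hf hg => exact hf.comp hg
  | treeBox _ _ hf _ => exact liftsCuts_treeBox hf _
  | treeη a b d => exact liftsCuts_treeη a b d

theorem hom_eq_of_length_word_le_one {A B : FreeObj X} (hB : B.word.length ≤ 1) (f g : A ⟶ B) :
    f = g := by
  obtain ⟨_, rfl⟩ := (unitFree f).exists_eq_eqToHom hB
  obtain ⟨_, rfl⟩ := (unitFree g).exists_eq_eqToHom hB
  rfl

theorem hom_eq {A B : FreeObj X} (f g : A ⟶ B) : f = g := by
  match B with
  | unit => exact hom_eq_of_length_word_le_one (B := unit) (Nat.zero_le 1) f g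
  | tree t =>
    induction t generalizing A with
    | ih1 x => exact hom_eq_of_length_word_le_one (B := of x) le_rfl f g
    | ih2 t₁ t₂ ih₁ ih₂ =>
      obtain ⟨p, q, c, a, b, hc, hf⟩ := liftsCuts f (.root t₁ t₂)
      obtain ⟨p', q', c', a', b', hc', hg⟩ := liftsCuts g (.root t₁ t₂)
      have hlen : p.leaves.length = p'.leaves.length :=
        congrArg List.length ((word_eq_of_hom a).trans (word_eq_of_hom a').symm)
      cases hc.eq_of_length_eq hc' hlen
      rw [ih₁ a a', ih₂ b b', ← hg] at hf
      exact (cancel_mono (𝟙 _)).mp hf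

/-! ### Morphisms and rotations -/

open Relation

/-- The planar binary tree underlying an object. The unit has no underlying tree; it is given the
tree `nil` of a generator, so that an object is determined by its shape only together with its
word. -/
def shape : FreeObj X → BinaryTree Unit
  | unit => .nil
  | tree t => t.shape

theorem reflTransGen_shape_of_hom {A B : FreeObj X} (f : A ⟶ B) :
    ReflTransGen Rotation A.shape B.shape := by
  induction unitFree f with
  | id A => exact .refl
  | comp _ _ hf hg => exact hf.trans hg
  | treeBox _ _ hf hg => exact Rotation.reflTransGen_node hf hg
  | treeη a b c => exact .single (.root a.shape b.shape c.shape)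

theorem exists_hom_of_rotation {s : FreeMagma X} {t' : BinaryTree Unit}
    (h : Rotation s.shape t') : ∃ t : FreeMagma X, t.shape = t' ∧ Nonempty (tree s ⟶ tree t) := by
  induction s generalizing t' with
  | ih1 x => cases h
  | ih2 s₁ s₂ ih₁ ih₂ =>
    change Rotation (.node () s₁.shape s₂.shape) t' at h
    generalize hs : s₁.shape = a at h
    cases h with
    | root a b c =>
      match s₁, hs with
      | .mul p q, hs =>
        obtain ⟨-, rfl, rfl⟩ := BinaryTree.node.inj hs
        exact ⟨.mul p (.mul q s₂), rfl, ⟨treeη p q s₂⟩⟩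
    | left _ h =>
      obtain ⟨t, rfl, ⟨f⟩⟩ := ih₁ (hs ▸ h)
      exact ⟨.mul t s₂, rfl, ⟨treeBox f (𝟙 _)⟩⟩
    | right _ h =>
      obtain ⟨t, rfl, ⟨f⟩⟩ := ih₂ h
      exact ⟨.mul s₁ t, hs ▸ rfl, ⟨treeBox (𝟙 _) f⟩⟩

theorem exists_hom_of_reflTransGen {A : FreeObj X} {t : BinaryTree Unit}
    (h : ReflTransGen Rotation A.shape t) : ∃ B : FreeObj X, B.shape = t ∧ Nonempty (A ⟶ B) := by
  induction h with
  | refl => exact ⟨A, rfl, ⟨𝟙 A⟩⟩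
  | tail _ h ih =>
    obtain ⟨_ | s, rfl, ⟨f⟩⟩ := ih
    · cases h
    · obtain ⟨t, ht, ⟨g⟩⟩ := exists_hom_of_rotation h
      exact ⟨tree t, ht, ⟨f ≫ g⟩⟩

theorem eq_of_shape_eq_of_leaves_eq {s t : FreeMagma X} (h : s.shape = t.shape)
    (hl : s.leaves = t.leaves) : s = t := by
  induction s generalizing t with
  | ih1 x =>
    match t with
    | .of y => rw [List.singleton_inj.mp hl]
    | .mul _ _ => cases h
  | ih2 s₁ s₂ ih₁ ih₂ =>
    match t with
    | .of _ => cases h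
    | .mul t₁ t₂ =>
      obtain ⟨-, h₁, h₂⟩ := BinaryTree.node.inj h
      have hlen : s₁.leaves.length = t₁.leaves.length := by
        rw [← numLeaves_shape_eq_length_leaves, h₁, numLeaves_shape_eq_length_leaves]
      obtain ⟨hl₁, hl₂⟩ := List.append_inj hl hlen
      exact congrArg₂ FreeMagma.mul (ih₁ h₁ hl₁) (ih₂ h₂ hl₂)

theorem eq_of_shape_eq_of_word_eq {A B : FreeObj X} (h : A.shape = B.shape)
    (hw : A.word = B.word) : A = B := by
  match A, B with
  | unit, B => exact (eq_unit_of_word_eq_nil hw.symm).symm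
  | A, unit => exact eq_unit_of_word_eq_nil hw
  | tree s, tree t => exact congrArg tree (eq_of_shape_eq_of_leaves_eq h hw)

theorem nonempty_hom_iff {A B : FreeObj X} (hw : A.word = B.word) :
    Nonempty (A ⟶ B) ↔ ReflTransGen Rotation A.shape B.shape := by
  refine ⟨fun ⟨f⟩ => reflTransGen_shape_of_hom f, fun h => ?_⟩
  obtain ⟨B', hB', ⟨f⟩⟩ := exists_hom_of_reflTransGen h
  obtain rfl := eq_of_shape_eq_of_word_eq hB' ((word_eq_of_hom f).symm.trans hw)
  exact ⟨f⟩

theorem hom_antisymm {A B : FreeObj X} (f : A ⟶ B) (g : B ⟶ A) : A = B :=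
  eq_of_shape_eq_of_word_eq
    (Rotation.reflTransGen_antisymm (reflTransGen_shape_of_hom f) (reflTransGen_shape_of_hom g))
    (word_eq_of_hom f)

theorem exists_shape_eq_leaves_eq {s : BinaryTree Unit} {l : List X}
    (h : s.numLeaves = l.length) : ∃ t : FreeMagma X, t.shape = s ∧ t.leaves = l := by
  induction s generalizing l with
  | nil =>
    obtain ⟨x, rfl⟩ := List.length_eq_one_iff.mp h.symm
    exact ⟨.of x, rfl, rfl⟩
  | node _ a b iha ihb =>
    rw [BinaryTree.numLeaves] at h
    obtain ⟨s, rfl, hs⟩ := iha (l := l.take a.numLeaves) (by rw [List.length_take]; omega)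
    obtain ⟨t, rfl, ht⟩ := ihb (l := l.drop s.shape.numLeaves) (by rw [List.length_drop]; omega)
    exact ⟨.mul s t, rfl, by rw [FreeMagma.leaves, hs, ht, List.take_append_drop]⟩

end FreeObj

/-- The bracketings of the word `l`, as a full subcategory of the free directed monoidal category;
`LaPlaza m` is the case of the word `x_1 x_2 ⋯ x_m`. -/
abbrev Bracketing {X : Type u} (l : List X) : Type u :=
  ObjectProperty.FullSubcategory (fun A : FreeObj X => A.word = l)

namespace Bracketing

open FreeObj

variable {X : Type u} {l : List X} {m : ℕ}

theorem numLeaves_shape (hl : l.length = m) (hm : 0 < m) (S : Bracketing l) :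
    S.obj.shape.numLeaves = m := by
  obtain ⟨_ | t, rfl⟩ := S
  · exact absurd hl hm.ne
  · exact (numLeaves_shape_eq_length_leaves t).trans hl

/-- The planar binary tree underlying a bracketing of a non-empty word. -/
def toTamari (hl : l.length = m) (hm : 0 < m) (S : Bracketing l) : Tamari m :=
  ⟨S.obj.shape, S.numLeaves_shape hl hm⟩

theorem toTamari_bijective (hl : l.length = m) (hm : 0 < m) :
    Function.Bijective (toTamari hl hm) := by
  refine ⟨fun S T h => ?_, fun ⟨s, hs⟩ => ?_⟩
  · exact ObjectProperty.FullSubcategory.ext <| eq_of_shape_eq_of_word_eq (congrArg Subtype.val h)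
      (S.property.trans T.property.symm)
  · obtain ⟨t, rfl, ht⟩ := exists_shape_eq_leaves_eq (hs.trans hl.symm)
    exact ⟨⟨tree t, ht⟩, rfl⟩

theorem nonempty_hom_iff_toTamari_le (hl : l.length = m) (hm : 0 < m) {S T : Bracketing l} :
    Nonempty (S ⟶ T) ↔ S.toTamari hl hm ≤ T.toTamari hl hm :=
  Iff.trans ⟨fun ⟨f⟩ => ⟨f.hom⟩, fun ⟨f⟩ => ⟨ObjectProperty.homMk f⟩⟩
    (nonempty_hom_iff (S.property.trans T.property.symm))

theorem hom_eq {S T : Bracketing l} (f g : S ⟶ T) : f = g :=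
  ObjectProperty.hom_ext _ (FreeObj.hom_eq f.hom g.hom)

theorem hom_antisymm {S T : Bracketing l} (f : S ⟶ T) (g : T ⟶ S) : S = T :=
  ObjectProperty.FullSubcategory.ext (FreeObj.hom_antisymm f.hom g.hom)

end Bracketing

theorem mainTheorem3_general {X : Type u} {m : ℕ} (l : List X) (hl : l.length = m) :
    (∀ (S T : Bracketing l) (f g : S ⟶ T), f = g) ∧
    (∀ S T : Bracketing l, Nonempty (S ⟶ T) → Nonempty (T ⟶ S) → S = T) ∧
    (0 < m →
      ∃ e : Bracketing l ≃ Tamari m,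
        (∀ (S : Bracketing l) (t : FreeMagma X), S.obj = FreeObj.tree t → (e S).1 = t.shape) ∧
        (∀ S T : Bracketing l, Nonempty (S ⟶ T) ↔ e S ≤ e T)) ∧
    (∀ s t : Tamari m, (∃ j, IsLUB {s, t} j) ∧ (∃ k, IsGLB {s, t} k)) :=
  ⟨fun _ _ => Bracketing.hom_eq,
    fun _ _ ⟨f⟩ ⟨g⟩ => Bracketing.hom_antisymm f g,
    fun hm => ⟨.ofBijective _ (Bracketing.toTamari_bijective hl hm),
      fun _ _ hS => congrArg FreeObj.shape hS,
      fun _ _ => Bracketing.nonempty_hom_iff_toTamari_le hl hm⟩,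
    fun s t => ⟨Tamari.exists_isLUB_pair s t, Tamari.exists_isGLB_pair s t⟩⟩

theorem mainTheorem3 (m : ℕ) :
    -- `𝓛_m` is a poset: parallel morphisms are equal, and the relation "there is a morphism
    -- from `S` to `T`" is antisymmetric
    (∀ (S T : LaPlaza m) (f g : S ⟶ T), f = g) ∧
    (∀ S T : LaPlaza m, Nonempty (S ⟶ T) → Nonempty (T ⟶ S) → S = T) ∧
    -- for `m ≥ 3`, forgetting labels identifies `𝓛_m` with the Tamari poset, which is a lattice
    (3 ≤ m →
      (∃ e : LaPlaza m ≃ Tamari m,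
        (∀ (S : LaPlaza m) (t : FreeMagma (Fin m)), S.obj = FreeObj.tree t →
          (e S).1 = t.shape) ∧
        (∀ S T : LaPlaza m, Nonempty (S ⟶ T) ↔ e S ≤ e T)) ∧
      (∀ s t : Tamari m, (∃ j, IsLUB {s, t} j) ∧ (∃ k, IsGLB {s, t} k))) := by
  obtain ⟨hom_eq, antisymm, equiv, lattice⟩ :=
    mainTheorem3_general (List.finRange m) List.length_finRange
  exact ⟨hom_eq, antisymm, fun hm => ⟨equiv (by omega), lattice⟩⟩
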